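/- **Setting.** A network has one server, $H$ relays and $K$ users; relay $i$ is connected to the users in $\mathcal N_i\subseteq[K]$, with $\bigcup_i\mathcal N_i=[K]$ and $\mathcal N_i\neq[K]$ for all $i$. Let $r_k$ be the number of relays connected to user $k$; the average user connectivity is $\frac1K\sum_k r_k$, and $\mathcal I_z=\{k: r_k=z\}$. User $k$ holds an intermediate value (IV) $\mathbf v_k$ of $V\ge 1$ bits. It sends a function of $\mathbf v_k$ to its relays, from which relay $i$ obtains a set $\mathcal V_i$ of local IVs of users in $\mathcal N_i$. Relay $i$ sends a $T_i$-bit function $X_i$ of the messages it received to the server; the server broadcasts a $T_0$-bit function $X_0$ of $(X_1,\dots,X_H)$ to all relays; from $X_0$ and $\mathcal V_i$ each relay $i$ must recover all of $(\mathbf v_1,\dots,\mathbf v_K)$ and sends a message to its users, from which each user $k$ must recover $\mathbf w_k$, where $(\mathbf w_1,\dots,\mathbf w_K)=\phi(\mathbf v_1,\dots,\mathbf v_K)$ and $\phi$ is a given (arbitrary) global update function (one for each $V$). All recoveries must be correct for all values of the IVs. The loads are $L_{up}=\sum_i T_i/V$ and $L_{down}=T_0/V$; a pair is achievable if it is the load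 pair of such a scheme for some $V\ge1$. $L^*_{up}$ and $L^*_{down}$ denote the least achievable uplink and downlink loads. **Coded scheme.** Users send their IVs uncoded. In round $z=1,\dots,H-1$ let $n_i^z=|\mathcal N_i\cap\mathcal I_z|-\min_{j\in[H]}|\mathcal N_i\cap\mathcal N_j\cap\mathcal I_z|$, and let $(\alpha_i^z)_i$ be an optimal solution of: minimize $\sum_i n_i^z\alpha_i$ subject to $\sum_{i:k\in\mathcal N_i}\alpha_i\ge1$ for all $k\in[K]$ and $0\le\alpha_i\le1$. Each $\mathbf v_k$ with $k\in\mathcal I_z$ is cut into segments $\mathbf v_{k,i}$ of $\alpha_i^zV$ bits ($i$ with $k\in\mathcal N_i$) which together make up $\mathbf v_k$, and relay $i$ sends $n_i^z$ linear combinations of the segments $\mathbf v_{k,i}$, $k\in\mathcal N_i\cap\mathcal I_z$. For some $\alpha^z$ with $1/\alpha^z$ a positive integer and all $\alpha_i^z/\alpha^z$ integers, the server cuts the received messages of round $z$ into pieces of $\alpha^zV$ bits and broadcasts $\frac1{\alpha^z}\big(|\mathcal I_z|-\min_i|\mathcal I_z\cap\mathcal N_i|\big)$ linear combinations of them. Linear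 combinations are symbol-wise over the field with $2^{\alpha^zV}$ elements; their coefficients are to be chosen so that all relays can decode. **Symmetric design.** The users are divided into $\binom Hr$ groups of equal positive size, one for each $r$-subset $\mathcal T\subseteq[H]$, and each user of the group of $\mathcal T$ is connected exactly to the relays in $\mathcal T$. **Theorem.** Let $1\le r<H$ and let $K\ge1$ be divisible by $\binom Hr$. Symmetric designs exist. Every symmetric design has average user connectivity $r$, and for every such design and every $\phi$: 1. For all sufficiently large $m$, with $V=rm$, there are coefficients for which the coded scheme is a valid scheme. Whenever the coded scheme is valid, for any $V\ge1$, its loads are $L_{up}=\frac{K(H-r)}{H-1}$ and $L_{down}=K-\frac{rK}{H}$. 2. These loads are therefore achieved simultaneously, and they are optimal for this network: $L_{up}=L^*_{up}=\frac{K(H-r)}{H-1}$ and $L_{down}=L^*_{down}=K-\frac{rK}{H}$. 3. They are also the least uplink load and the least downlink load achievable on any network with $H$ relays, $K$ users and average user connectivity $r$. -/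

import Mathlib

noncomputable section

/-- Messages of `n` bits (the paper's alphabet with `2 ^ n` elements). -/
abbrev Bits (n : ℕ) : Type := Fin n → ZMod 2

/-- A two-hop network with `H` relays and `K` users. `N i` is the set of users connected to
relay `i`. Every user is connected to some relay, and no relay is connected to all users. -/
structure Network (H K : ℕ) where
  N : Fin H → Finset (Fin K)
  cover : ∀ k, ∃ i, k ∈ N i
  nontrivial : ∀ i, N i ≠ Finset.univ

namespace Network

variable {H K : ℕ}

/-- The relays to which user `k` is connected. -/
def relays (G : Network H K) (k : Fin K) : Finset (Fin H) :=
  Finset.univ.filter fun i => k ∈ G.N i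

/-- The average user connectivity: the number of links divided by the number of users. -/
def avgConnectivity (G : Network H K) : ℝ :=
  (∑ k, ((G.relays k).card : ℝ)) / K

/-- The users connected to exactly `z` relays. -/
def usersOf (G : Network H K) (z : ℕ) : Finset (Fin K) :=
  Finset.univ.filter fun k => (G.relays k).card = z

/-- The symmetric (combination network) design: the users are divided into groups of one common
size `η ≥ 1`, one group for each `r`-subset `T` of the relays, and the users of the group of `T`
are connected to exactly the relays in `T`. -/
def IsSymmetricDesign (G : Network H K) (r : ℕ) : Prop :=
  (∀ k, (G.relays k).card = r) ∧
    ∃ η : ℕ, 0 < η ∧ ∀ T : Finset (Fin H), T.card = r →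
      (Finset.univ.filter fun k => G.relays k = T).card = η

/-- The number of combinations sent by relay `i` in round `z`:
`|N_i ∩ I_z| - min_j |N_i ∩ N_j ∩ I_z|` (the minimum is over all relays `j`, and `j = i` shows
that the subtraction does not truncate). -/
def upCount (G : Network H K) (z : ℕ) (i : Fin H) : ℕ :=
  (G.N i ∩ G.usersOf z).card - ⨅ j : Fin H, (G.N i ∩ G.N j ∩ G.usersOf z).card

/-- `|I_z| - min_i |I_z ∩ N_i|`. -/
def downCount (G : Network H K) (z : ℕ) : ℕ :=
  (G.usersOf z).card - ⨅ i : Fin H, (G.usersOf z ∩ G.N i).card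

/-- Constraints of the linear program that determines the fractions `α_i` of a round. -/
def IsFeasible (G : Network H K) (α : Fin H → ℝ) : Prop :=
  (∀ k, 1 ≤ ∑ i, α i * (if k ∈ G.N i then 1 else 0)) ∧ ∀ i, 0 ≤ α i ∧ α i ≤ 1

/-- Objective of that linear program in round `z`. -/
def objective (G : Network H K) (z : ℕ) (α : Fin H → ℝ) : ℝ :=
  ∑ i, (G.upCount z i : ℝ) * α i

/-- `α` is an optimal solution of the linear program of round `z`. -/
def IsOptimalSplit (G : Network H K) (z : ℕ) (α : Fin H → ℝ) : Prop :=
  G.IsFeasible α ∧ ∀ α' : Fin H → ℝ, G.IsFeasible α' → G.objective z α ≤ G.objective z α'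

end Network

/-- The communication rounds `z = 1, …, H - 1`. -/
abbrev Round (H : ℕ) : Type := {z : ℕ // z ∈ Finset.Icc 1 (H - 1)}

/-- A global update function for each bit size `V` of the intermediate values. -/
abbrev GlobalUpdate (K : ℕ) : Type := (V : ℕ) → (Fin K → Bits V) → (Fin K → Bits V)

/-- A communication scheme on the network `G`, for intermediate values (IVs) of `V` bits and the
global update function `φ`: all encoders and decoders, error-free for all values of the IVs. -/
structure Scheme {H K : ℕ} (G : Network H K) (V : ℕ)
    (φ : (Fin K → Bits V) → (Fin K → Bits V)) where
  /-- bits sent by user `k` -/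
  TU : Fin K → ℕ
  /-- bits sent by relay `i` to the server -/
  T : Fin H → ℕ
  /-- bits broadcast by the server -/
  T₀ : ℕ
  /-- bits sent by relay `i` to its users -/
  TE : Fin H → ℕ
  /-- the indices of the local IVs which relay `i` obtains from its users -/
  loc : Fin H → Finset (Fin K)
  loc_subset : ∀ i, loc i ⊆ G.N i
  userEnc : (k : Fin K) → Bits V → Bits (TU k)
  localDec : (i : Fin H) → ((k : {k // k ∈ G.N i}) → Bits (TU k)) → ({k // k ∈ loc i} → Bits V)
  relayEnc : (i : Fin H) → ((k : {k // k ∈ G.N i}) → Bits (TU k)) → Bits (T i)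
  serverEnc : ((i : Fin H) → Bits (T i)) → Bits T₀
  relayDec : (i : Fin H) → Bits T₀ → ({k // k ∈ loc i} → Bits V) → (Fin K → Bits V)
  relayDownEnc : (i : Fin H) → Bits T₀ → ({k // k ∈ loc i} → Bits V) → Bits (TE i)
  userDec : (k : Fin K) → ((i : {i // k ∈ G.N i}) → Bits (TE i)) → Bits V
  /-- the local IVs are obtained correctly -/
  localDec_correct : ∀ (v : Fin K → Bits V) (i : Fin H) (k : {k // k ∈ loc i}),
    localDec i (fun l => userEnc l (v l)) k = v k
  /-- every relay recovers all IVs from the server's message and its local IVs -/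
  relayDec_correct : ∀ (v : Fin K → Bits V) (i : Fin H),
    relayDec i (serverEnc fun j => relayEnc j fun l => userEnc l (v l))
      (localDec i fun l => userEnc l (v l)) = v
  /-- every user recovers its updated model -/
  userDec_correct : ∀ (v : Fin K → Bits V) (k : Fin K),
    userDec k (fun i => relayDownEnc i (serverEnc fun j => relayEnc j fun l => userEnc l (v l))
      (localDec i fun l => userEnc l (v l))) = φ v k

namespace Scheme

variable {H K : ℕ} {G : Network H K} {V : ℕ} {φ : (Fin K → Bits V) → (Fin K → Bits V)}

/-- The message from relay `i` to the server when the IVs are `v`. -/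
def upMsg (S : Scheme G V φ) (v : Fin K → Bits V) (i : Fin H) : Bits (S.T i) :=
  S.relayEnc i fun l => S.userEnc l (v l)

/-- The message broadcast by the server when the IVs are `v`. -/
def downMsg (S : Scheme G V φ) (v : Fin K → Bits V) : Bits S.T₀ :=
  S.serverEnc (S.upMsg v)

/-- The uplink communication load from the relays to the server. -/
def upLoad (S : Scheme G V φ) : ℝ := (∑ i, (S.T i : ℝ)) / V

/-- The downlink communication load from the server to the relays. -/
def downLoad (S : Scheme G V φ) : ℝ := (S.T₀ : ℝ) / V

end Scheme

namespace Network

variable {H K : ℕ}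

/-- The load pair `(Lup, Ldown)` between relays and server is achievable. -/
def Achievable (G : Network H K) (φ : GlobalUpdate K) (Lup Ldown : ℝ) : Prop :=
  ∃ V : ℕ, 0 < V ∧ ∃ S : Scheme G V (φ V), S.upLoad = Lup ∧ S.downLoad = Ldown

/-- All achievable uplink loads; the optimal uplink load is the least element. -/
def upLoads (G : Network H K) (φ : GlobalUpdate K) : Set ℝ :=
  {L | ∃ L', G.Achievable φ L L'}

/-- All achievable downlink loads; the optimal downlink load is the least element. -/
def downLoads (G : Network H K) (φ : GlobalUpdate K) : Set ℝ :=
  {L | ∃ L', G.Achievable φ L' L}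

end Network

/-- The parameters of the coded scheme. In round `z` an IV of `V` bits is cut into `q z`
consecutive symbols of `b z` bits, each identified with an element of the field with `2 ^ b z`
elements (so `1 / q z` is the paper's downlink fraction `α^z`). -/
structure CodingParams {H K : ℕ} (G : Network H K) (V : ℕ) where
  /-- relay `i` is responsible for `α z i * V` bits of each of its IVs of round `z` -/
  α : Round H → Fin H → ℝ
  optimal : ∀ z : Round H, G.IsOptimalSplit z (α z)
  /-- symbols per IV -/
  q : Round H → ℕ
  /-- bits per symbol -/
  b : Round H → ℕ
  size : ∀ z, q z * b z = V
  /-- symbols per segment of relay `i` -/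
  s : Round H → Fin H → ℕ
  seg_size : ∀ z i, (s z i : ℝ) = α z i * q z
  ident : (z : Round H) → Bits (b z) ≃ₗ[ZMod 2] GaloisField 2 (b z)
  /-- the positions in `v_k` of the symbols of the segment `v_{k,i}` -/
  seg : (z : Round H) → Fin K → (i : Fin H) → Fin (s z i) → Fin (q z)
  /-- the segments of the relays connected to `k` make up the whole IV (when their sizes add up
  to `V`, this forces the segments to be disjoint) -/
  seg_cover : ∀ (z : Round H) (k : Fin K), k ∈ G.usersOf z → ∀ p : Fin (q z),
    ∃ i, k ∈ G.N i ∧ ∃ t, seg z k i t = p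
  /-- coefficients of the linear combinations formed by the relays -/
  c : (z : Round H) → (i : Fin H) → Fin (G.upCount z i) → Fin K → GaloisField 2 (b z)
  /-- coefficients of the linear combinations formed by the server -/
  d : (z : Round H) → Fin (q z * G.downCount z) → (i : Fin H) → Fin (G.upCount z i) →
    Fin (s z i) → GaloisField 2 (b z)

namespace CodingParams

variable {H K : ℕ} {G : Network H K} {V : ℕ}

/-- The `p`-th symbol of the IV `x` in round `z`. -/
def symbol (P : CodingParams G V) (z : Round H) (x : Bits V) (p : Fin (P.q z)) :
    GaloisField 2 (P.b z) :=
  P.ident z fun u => x (Fin.cast (P.size z) (finProdFinEquiv (p, u)))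

/-- The `t`-th symbol of the `j`-th linear combination of relay `i` in round `z`, a combination
of the segments `v_{k,i}` with `k ∈ N_i ∩ I_z`. -/
def upSymbol (P : CodingParams G V) (v : Fin K → Bits V) (z : Round H) (i : Fin H)
    (j : Fin (G.upCount z i)) (t : Fin (P.s z i)) : GaloisField 2 (P.b z) :=
  ∑ k ∈ G.N i ∩ G.usersOf z, P.c z i j k * P.symbol z (v k) (P.seg z k i t)

/-- The `n`-th linear combination of the server in round `z`, a combination of the symbols
received from the relays in that round. -/
def downSymbol (P : CodingParams G V) (v : Fin K → Bits V) (z : Round H)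
    (n : Fin (P.q z * G.downCount z)) : GaloisField 2 (P.b z) :=
  ∑ i, ∑ j, ∑ t, P.d z n i j t * P.upSymbol v z i j t

end CodingParams

namespace Scheme

variable {H K : ℕ} {G : Network H K} {V : ℕ} {φ : (Fin K → Bits V) → (Fin K → Bits V)}

/-- `S` is an instance of the coded scheme: each user sends its IV uncoded; each relay sends,
over all rounds `z = 1, …, H - 1`, its linear combinations; the server sends its linear
combinations of the received symbols. The bijections `lay` and `lay₀` list the bits of a message
by round, combination, symbol and bit within the symbol. -/
def IsCoded (S : Scheme G V φ) : Prop :=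
  ∃ P : CodingParams G V,
    (∃ hT : ∀ k, S.TU k = V, ∀ (k : Fin K) (x : Bits V) (t : Fin V),
      S.userEnc k x (Fin.cast (hT k).symm t) = x t) ∧
    (∀ i, ∃ lay : Fin (S.T i) ≃
        (Σ z : Round H, Fin (G.upCount z i) × Fin (P.s z i) × Fin (P.b z)),
      ∀ (v : Fin K → Bits V) (z : Round H) (j : Fin (G.upCount z i)) (t : Fin (P.s z i)),
        P.ident z (fun u => S.upMsg v i (lay.symm ⟨z, j, t, u⟩)) = P.upSymbol v z i j t) ∧
    (∃ lay₀ : Fin S.T₀ ≃ (Σ z : Round H, Fin (P.q z * G.downCount z) × Fin (P.b z)),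
      ∀ (v : Fin K → Bits V) (z : Round H) (n : Fin (P.q z * G.downCount z)),
        P.ident z (fun u => S.downMsg v (lay₀.symm ⟨z, n, u⟩)) = P.downSymbol v z n)

end Scheme

end

/-! Converse: a relay recovers all `K * V` bits from the server's message and the IVs in its
neighbourhood, so the server must supply the bits of the users it misses. Its own uplink message
depends only on IVs it may be assumed to know, so the uplink messages of the other relays must
already supply those bits. Averaging the two cut-set bounds (`le_T₀_add`, `le_sum_T_add`) over all
relays leaves only the total number `r * K` of links, whatever the network.

Achievability: in a symmetric design every relay misses `D` users and `u` users of any relay are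
missed by any given other relay. Only round `r` is active, and splitting each IV into `r` equal
segments is optimal. Relay `i` sends `u` Vandermonde combinations of its segments. Relay `l` cancels
the IVs it knows and is left with `u` unknowns, hence solves for them. To deliver all uplink symbols
to all relays, the server adds those of one fixed relay to those of each other relay
(`exists_broadcast_coefficients`). This takes `(H - 1) * u = r * D` symbols, exactly the prescribed
number.

The loads hold for every optimal split, since all optimal splits have the same sum
(`sum_of_isOptimalSplit`). -/

open Finset

/-! ### Counting links -/

namespace Network

variable {H K : ℕ} (G : Network H K)

theorem mem_relays {k : Fin K} {i : Fin H} : i ∈ G.relays k ↔ k ∈ G.N i := by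
  simp [relays]

theorem mem_usersOf {k : Fin K} {z : ℕ} : k ∈ G.usersOf z ↔ (G.relays k).card = z := by
  simp [usersOf]

theorem sum_card_N : ∑ i, (G.N i).card = ∑ k, (G.relays k).card := by
  have := Finset.sum_card_bipartiteAbove_eq_sum_card_bipartiteBelow
    (s := (univ : Finset (Fin H))) (t := (univ : Finset (Fin K))) (fun i k => k ∈ G.N i)
  simpa [bipartiteAbove, bipartiteBelow, relays] using this

theorem sum_card_N_of_avgConnectivity (hK : 0 < K) {r : ℝ} (h : G.avgConnectivity = r) :
    ∑ i, ((G.N i).card : ℝ) = r * K := by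
  have hK' : (K : ℝ) ≠ 0 := by positivity
  rw [avgConnectivity, div_eq_iff hK'] at h
  rw [← h]
  exact_mod_cast G.sum_card_N

end Network

/-! ### Cut-set lower bounds on the loads -/

namespace Scheme

variable {H K : ℕ} {G : Network H K} {V : ℕ} {φ : (Fin K → Bits V) → (Fin K → Bits V)}

/-- A relay tells any two families of IVs apart by the server's message and its local IVs. -/
theorem eq_of_downMsg_eq (S : Scheme G V φ) (i : Fin H) {v v' : Fin K → Bits V}
    (hd : S.downMsg v = S.downMsg v') (hl : ∀ k ∈ S.loc i, v k = v' k) : v = v' := by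
  have h1 := S.relayDec_correct v i
  have h2 := S.relayDec_correct v' i
  have e : (S.localDec i fun l => S.userEnc l (v l)) =
      S.localDec i fun l => S.userEnc l (v' l) := by
    funext k
    rw [S.localDec_correct v i k, S.localDec_correct v' i k, hl k k.2]
  have e' : (S.serverEnc fun j => S.relayEnc j fun l => S.userEnc l (v l)) =
      S.serverEnc fun j => S.relayEnc j fun l => S.userEnc l (v' l) := hd
  rw [← h1, ← h2, e, e']

theorem upMsg_congr (S : Scheme G V φ) (i : Fin H) {v v' : Fin K → Bits V}
    (h : ∀ k ∈ G.N i, v k = v' k) : S.upMsg v i = S.upMsg v' i := by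
  unfold upMsg
  congr 1
  funext l
  rw [h l l.2]

/-- The server's message together with the IVs of `G.N i` determines all IVs; compare cardinalities.
-/
theorem le_T₀_add (S : Scheme G V φ) (i : Fin H) : K * V ≤ S.T₀ + (G.N i).card * V := by
  have inj : Function.Injective (fun v : Fin K → Bits V =>
      ((S.downMsg v, fun k => v k) : Bits S.T₀ × ({k // k ∈ G.N i} → Bits V))) := by
    intro v v' h
    simp only [Prod.mk.injEq] at h
    exact S.eq_of_downMsg_eq i h.1 fun k hk => congrFun h.2 ⟨k, S.loc_subset i hk⟩
  have := Fintype.card_le_of_injective _ inj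
  simp only [Fintype.card_prod, Fintype.card_fun, Fintype.card_fin,
    Fintype.card_coe, ← pow_mul, ← pow_add] at this
  have := (Nat.pow_le_pow_iff_right (by norm_num)).1 this
  linarith

/-- The server's message is a function of the uplink messages, and that of relay `i` can be
recomputed from the IVs of `G.N i`, so it does not count. -/
theorem le_sum_T_add (S : Scheme G V φ) (i : Fin H) :
    K * V ≤ ∑ j ∈ univ.erase i, S.T j + (G.N i).card * V := by
  have inj : Function.Injective (fun v : Fin K → Bits V =>
      ((fun j => S.upMsg v j, fun k => v k) :
        ((j : {j // j ∈ univ.erase i}) → Bits (S.T j)) × ({k // k ∈ G.N i} → Bits V))) := by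
    intro v v' h
    simp only [Prod.mk.injEq] at h
    have hN : ∀ k ∈ G.N i, v k = v' k := fun k hk => congrFun h.2 ⟨k, hk⟩
    refine S.eq_of_downMsg_eq i ?_ fun k hk => hN k (S.loc_subset i hk)
    unfold downMsg
    congr 1
    funext j
    by_cases hj : j = i
    · subst hj
      exact S.upMsg_congr j hN
    · exact congrFun h.1 ⟨j, by simp [hj]⟩
  have := Fintype.card_le_of_injective _ inj
  simp only [Fintype.card_prod, Fintype.card_fun, Fintype.card_pi, Fintype.card_fin,
    Fintype.card_coe, ← pow_mul, prod_pow_eq_pow_sum] at this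
  rw [← pow_add] at this
  have := (Nat.pow_le_pow_iff_right (by norm_num)).1 this
  rw [sum_coe_sort (univ.erase i) (fun j => S.T j)] at this
  linarith

theorem le_downLoad (S : Scheme G V φ) (hV : 0 < V) (hH : 0 < H) (hK : 0 < K) {r : ℝ}
    (h : G.avgConnectivity = r) : (K : ℝ) - r * K / H ≤ S.downLoad := by
  have hs : ∑ _i : Fin H, (K * V : ℝ) ≤ ∑ i, ((S.T₀ : ℝ) + (G.N i).card * V) :=
    sum_le_sum fun i _ => by exact_mod_cast S.le_T₀_add i
  rw [sum_add_distrib, ← sum_mul univ (fun i => ((G.N i).card : ℝ)), G.sum_card_N_of_avgConnectivity hK h] at hs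
  simp only [sum_const, card_univ, Fintype.card_fin, nsmul_eq_mul] at hs
  have hV' : (0 : ℝ) < V := by exact_mod_cast hV
  have hH' : (0 : ℝ) < H := by exact_mod_cast hH
  rw [downLoad, le_div_iff₀ hV', ← sub_nonneg]
  have : (S.T₀ : ℝ) - (K - r * K / H) * V = (H * S.T₀ + r * K * V - H * (K * V)) / H := by
    field_simp
    ring
  rw [this]
  exact div_nonneg (by linarith) hH'.le

theorem le_upLoad (S : Scheme G V φ) (hV : 0 < V) (hH : 1 < H) (hK : 0 < K) {r : ℝ}
    (h : G.avgConnectivity = r) : (K : ℝ) * ((H : ℝ) - r) / ((H : ℝ) - 1) ≤ S.upLoad := by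
  have hs : ∑ _i : Fin H, (K * V : ℝ) ≤
      ∑ i, ((∑ j, (S.T j : ℝ)) - S.T i + (G.N i).card * V) :=
    sum_le_sum fun i _ => by
      have := S.le_sum_T_add i
      rw [← sum_erase_add _ _ (mem_univ i), add_sub_cancel_right]
      exact_mod_cast this
  rw [sum_add_distrib, ← sum_mul univ (fun i => ((G.N i).card : ℝ)), G.sum_card_N_of_avgConnectivity hK h, sum_sub_distrib] at hs
  simp only [sum_const, card_univ, Fintype.card_fin, nsmul_eq_mul] at hs
  have hV' : (0 : ℝ) < V := by exact_mod_cast hV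
  have hH' : (0 : ℝ) < (H : ℝ) - 1 := by
    have : (1 : ℝ) < H := by exact_mod_cast hH
    linarith
  rw [upLoad, div_le_div_iff₀ hH' hV']
  linarith

end Scheme

/-! ### Counting subsets of fixed size -/

theorem Finset.card_filter_card_eq_and_notMem {α : Type*} [Fintype α] [DecidableEq α] (r : ℕ)
    (j : α) : #{T : Finset α | T.card = r ∧ j ∉ T} = (Fintype.card α - 1).choose r := by
  have : ({T : Finset α | T.card = r ∧ j ∉ T} : Finset (Finset α)) =
      powersetCard r (univ.erase j) := by
    ext T
    simp only [mem_filter, mem_univ, true_and, mem_powersetCard, subset_erase, subset_univ]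
    tauto
  rw [this, card_powersetCard, card_erase_of_mem (mem_univ j), card_univ]

theorem Finset.card_filter_card_eq_and_mem_and_notMem {α : Type*} [Fintype α] [DecidableEq α]
    {r : ℕ} (hr : 1 ≤ r) {i j : α} (hij : i ≠ j) :
    #{T : Finset α | T.card = r ∧ i ∈ T ∧ j ∉ T} = (Fintype.card α - 2).choose (r - 1) := by
  have h : ({T : Finset α | T.card = r ∧ i ∈ T ∧ j ∉ T} : Finset (Finset α)) =
      (powersetCard (r - 1) ((univ.erase j).erase i)).image (insert i) := by
    ext T
    simp only [mem_filter, mem_univ, true_and, mem_image, mem_powersetCard, subset_erase,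
      subset_univ]
    constructor
    · rintro ⟨hT, hi, hj⟩
      refine ⟨T.erase i, ⟨⟨fun h => hj (mem_of_mem_erase h), notMem_erase i T⟩, ?_⟩,
        insert_erase hi⟩
      rw [card_erase_of_mem hi, hT]
    · rintro ⟨S, ⟨⟨hj, hi⟩, hS⟩, rfl⟩
      refine ⟨?_, mem_insert_self i S, ?_⟩
      · rw [card_insert_of_notMem hi, hS]
        omega
      · simp [hj, hij.symm]
  rw [h, card_image_of_injOn, card_powersetCard, card_erase_of_mem (by simp [hij]),
    card_erase_of_mem (mem_univ j), card_univ, Nat.sub_sub]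
  intro S hS S' hS' e
  simp only [mem_coe, mem_powersetCard, subset_erase] at hS hS'
  rw [← erase_insert hS.1.2, ← erase_insert hS'.1.2]
  exact congrArg (fun T => T.erase i) e

/-! ### Symmetric designs: existence and intersection numbers -/

namespace Network

variable {H K r : ℕ} {G : Network H K}

/-- The existence of a symmetric design. -/
theorem exists_isSymmetricDesign (hr : 1 ≤ r) (hrH : r < H) (hK : 0 < K)
    (hdvd : H.choose r ∣ K) : ∃ G : Network H K, G.IsSymmetricDesign r := by
  obtain ⟨η, rfl⟩ := hdvd
  have hη : 0 < η := Nat.pos_of_ne_zero (by rintro rfl; simp at hK)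
  have hcard : Fintype.card {T : Finset (Fin H) // T.card = r} = H.choose r := by
    rw [Fintype.card_finset_len, Fintype.card_fin]
  let e : Fin (H.choose r * η) ≃ {T : Finset (Fin H) // T.card = r} × Fin η :=
    finProdFinEquiv.symm.trans
      (Equiv.prodCongr (Fintype.equivFinOfCardEq hcard).symm (Equiv.refl _))
  let G : Network H (H.choose r * η) :=
    { N := fun i => univ.filter fun k => i ∈ (e k).1.1
      cover := fun k => by
        have hne : ((e k).1.1).Nonempty := by
          rw [← card_pos, (e k).1.2]
          exact hr
        obtain ⟨i, hi⟩ := hne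
        exact ⟨i, by simpa using hi⟩
      nontrivial := fun i h => by
        -- As `r < H`, some `r`-subset avoids `i`; a user of its group is not connected to `i`.
        obtain ⟨T, hT, hc⟩ := exists_subset_card_eq (s := univ.erase i) (n := r) (by
          rw [card_erase_of_mem (mem_univ i), card_univ, Fintype.card_fin]
          omega)
        have := mem_univ (e.symm (⟨T, hc⟩, ⟨0, hη⟩))
        rw [← h] at this
        simp only [mem_filter, mem_univ, true_and, Equiv.apply_symm_apply] at this
        exact notMem_erase i univ (hT this) }
  have hrel : ∀ k, G.relays k = (e k).1.1 := fun k => by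
    ext i
    rw [mem_relays]
    simp [G]
  refine ⟨G, fun k => by rw [hrel, (e k).1.2], η, hη, fun T hT => ?_⟩
  have : (univ.filter fun k => G.relays k = T) =
      (univ : Finset (Fin η)).image fun x => e.symm (⟨T, hT⟩, x) := by
    ext k
    simp only [mem_filter, mem_univ, true_and, hrel, mem_image]
    constructor
    · intro h
      exact ⟨(e k).2, e.symm_apply_eq.2 (Prod.ext (Subtype.ext h.symm) rfl)⟩
    · rintro ⟨x, rfl⟩
      simp
  rw [this, card_image_of_injective _ fun x y h => by simpa using h, card_univ, Fintype.card_fin]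

namespace IsSymmetricDesign

theorem avgConnectivity_eq (h : G.IsSymmetricDesign r) (hK : 0 < K) : G.avgConnectivity = r := by
  have hK' : (K : ℝ) ≠ 0 := by positivity
  simp only [avgConnectivity, h.1, sum_const, card_univ, Fintype.card_fin, nsmul_eq_mul]
  field_simp

theorem usersOf_eq (h : G.IsSymmetricDesign r) (z : ℕ) :
    G.usersOf z = if z = r then univ else ∅ := by
  ext k
  rw [mem_usersOf, h.1]
  split_ifs with hz <;> simp [hz, eq_comm (a := r)]

/-- All fibres of `G.relays` over `r`-subsets have size `η`, so counting users by their relays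
reduces to counting `r`-subsets. -/
theorem card_filter_relays (h : G.IsSymmetricDesign r) : ∃ η : ℕ, 0 < η ∧
    ∀ (p : Finset (Fin H) → Prop) [DecidablePred p],
      #{k | p (G.relays k)} = η * #{T : Finset (Fin H) | T.card = r ∧ p T} := by
  obtain ⟨hr, η, hη, hT⟩ := h
  refine ⟨η, hη, fun p _ => ?_⟩
  rw [card_eq_sum_card_fiberwise (f := G.relays)
    (t := {T : Finset (Fin H) | T.card = r ∧ p T}), mul_comm, ← smul_eq_mul]
  · refine sum_const_nat fun T hT' => ?_
    simp only [mem_filter, mem_univ, true_and] at hT'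
    rw [← hT T hT'.1, filter_filter]
    congr 1
    ext k
    simp only [mem_filter, mem_univ, true_and, and_iff_right_iff_imp]
    rintro rfl
    exact hT'.2
  · intro k hk
    simpa [hr] using hk

/-- Each relay misses equally many users, and for any two relays equally many users are connected
to the first but not to the second. -/
theorem exists_card_compl_card_sdiff (h : G.IsSymmetricDesign r) (hr : 1 ≤ r) :
    ∃ u D : ℕ, (∀ i, (G.N i)ᶜ.card = D) ∧ ∀ i j, i ≠ j → (G.N i \ G.N j).card = u := by
  obtain ⟨η, -, hη⟩ := h.card_filter_relays
  refine ⟨η * (H - 2).choose (r - 1), η * (H - 1).choose r, fun i => ?_, fun i j hij => ?_⟩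
  · have := hη (fun T => i ∉ T)
    rw [card_filter_card_eq_and_notMem, Fintype.card_fin] at this
    rw [← this]
    congr 1
    ext k
    simp [mem_relays]
  · have := hη (fun T => i ∈ T ∧ j ∉ T)
    rw [card_filter_card_eq_and_mem_and_notMem hr hij, Fintype.card_fin] at this
    rw [← this]
    congr 1
    ext k
    simp [mem_relays]

theorem sum_card_compl (h : G.IsSymmetricDesign r) : ∑ i, (G.N i)ᶜ.card = K * (H - r) := by
  have := sum_card_bipartiteAbove_eq_sum_card_bipartiteBelow
    (s := (univ : Finset (Fin H))) (t := (univ : Finset (Fin K))) (fun i k => k ∉ G.N i)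
  have e : ∀ k, #(univ.bipartiteBelow (fun i k => k ∉ G.N i) k) = H - r := fun k => by
    have hc : (G.relays k)ᶜ.card = H - r := by rw [card_compl, h.1 k, Fintype.card_fin]
    rw [← hc]
    congr 1
    ext i
    simp [bipartiteBelow, mem_relays]
  simp only [e, sum_const, card_univ, Fintype.card_fin, smul_eq_mul] at this
  rw [← this]
  refine sum_congr rfl fun i _ => ?_
  congr 1
  ext k
  simp [bipartiteAbove]

/-- Double counting of triples: user `k` contributes the pairs in `G.relays k × (G.relays k)ᶜ`. This
avoids binomial identities for `u`. -/
theorem sum_card_sdiff (h : G.IsSymmetricDesign r) :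
    ∑ i, ∑ j, (G.N i \ G.N j).card = K * (r * (H - r)) := by
  have := sum_card_bipartiteAbove_eq_sum_card_bipartiteBelow
    (s := (univ : Finset (Fin H × Fin H))) (t := (univ : Finset (Fin K)))
    (fun p k => k ∈ G.N p.1 \ G.N p.2)
  have e : ∀ k, #(univ.bipartiteBelow
      (fun (p : Fin H × Fin H) k => k ∈ G.N p.1 \ G.N p.2) k) = r * (H - r) := fun k => by
    have hc : (G.relays k)ᶜ.card = H - r := by rw [card_compl, h.1 k, Fintype.card_fin]
    rw [← hc, ← h.1 k, ← card_product]
    congr 1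
    ext p
    simp [bipartiteBelow, mem_relays]
  simp only [e, sum_const, card_univ, Fintype.card_fin, smul_eq_mul] at this
  rw [← this, ← univ_product_univ, sum_product]
  refine sum_congr rfl fun i _ => sum_congr rfl fun j _ => ?_
  congr 1
  ext k
  simp [bipartiteAbove]

/-- The numbers of combinations in a symmetric design. -/
theorem exists_upCount_downCount (h : G.IsSymmetricDesign r) (hr : 1 ≤ r) (hrH : r < H) :
    ∃ u D : ℕ, (∀ i, (G.N i)ᶜ.card = D) ∧ (∀ i j, i ≠ j → (G.N i \ G.N j).card = u) ∧
      (∀ z i, G.upCount z i = if z = r then u else 0) ∧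
      (∀ z, G.downCount z = if z = r then D else 0) ∧
      (H : ℝ) * D = K * (H - r) ∧ (H : ℝ) * ((H - 1) * u) = K * (r * (H - r)) := by
  obtain ⟨u, D, hD, hu⟩ := h.exists_card_compl_card_sdiff hr
  have hH : 2 ≤ H := by omega
  have : Nontrivial (Fin H) := Fin.nontrivial_iff_two_le.2 hH
  have : Nonempty (Fin H) := inferInstance
  refine ⟨u, D, hD, hu, fun z i => ?_, fun z => ?_, ?_, ?_⟩
  · rw [upCount, h.usersOf_eq]
    split_ifs with hz
    · simp only [inter_univ]
      obtain ⟨j, hj⟩ := exists_ne i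
      have key : ∀ j, j ≠ i → u + (G.N i ∩ G.N j).card = (G.N i).card := fun j hj => by
        rw [← hu i j hj.symm, card_sdiff_add_card_inter]
      -- Every `j ≠ i` gives the same intersection size, and `j = i` gives at least as much, so any
      -- `j ≠ i` attains the minimum.
      have : ⨅ j, (G.N i ∩ G.N j).card = (G.N i ∩ G.N j).card := by
        refine le_antisymm (ciInf_le' _ j) (le_ciInf fun j' => ?_)
        by_cases h' : j' = i
        · rw [h', inter_self, ← key j hj]
          omega
        · have := key j hj
          have := key j' h'
          omega
      rw [this, ← key j hj]
      omega
    · simp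
  · rw [downCount, h.usersOf_eq]
    split_ifs with hz
    · have key : ∀ i, (G.N i).card = K - D := fun i => by
        have := card_add_card_compl (G.N i)
        rw [hD, Fintype.card_fin] at this
        omega
      have hDK : D ≤ K := by
        rw [← hD (Classical.arbitrary _)]
        simpa using card_le_univ (G.N (Classical.arbitrary _))ᶜ
      simp only [univ_inter, key, ciInf_const, card_univ, Fintype.card_fin]
      omega
    · simp
  · have := h.sum_card_compl
    simp only [hD, sum_const, card_univ, Fintype.card_fin, smul_eq_mul] at this
    have h' : ((H * D : ℕ) : ℝ) = (K * (H - r) : ℕ) := by rw [this]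
    push_cast [hrH.le] at h'
    exact h'
  · have := h.sum_card_sdiff
    have e : ∀ i, ∑ j, (G.N i \ G.N j).card = (H - 1) * u := fun i => by
      rw [← sum_erase_add _ _ (mem_univ i), sdiff_self, bot_eq_empty, card_empty, add_zero,
        sum_const_nat (m := u) fun j hj => hu i j (ne_of_mem_erase hj).symm,
        card_erase_of_mem (mem_univ i), card_univ, Fintype.card_fin]
    simp only [e, sum_const, card_univ, Fintype.card_fin, smul_eq_mul] at this
    have h' : ((H * ((H - 1) * u) : ℕ) : ℝ) = (K * (r * (H - r)) : ℕ) := by rw [this]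
    push_cast [hrH.le, (by omega : 1 ≤ H)] at h'
    exact h'

end IsSymmetricDesign

end Network

/-! ### The linear program and the loads of the coded scheme -/

namespace Network.IsSymmetricDesign

variable {H K r : ℕ} {G : Network H K}

theorem isFeasible_const (h : G.IsSymmetricDesign r) (hr : 1 ≤ r) :
    G.IsFeasible fun _ => 1 / (r : ℝ) := by
  have hr' : (1 : ℝ) ≤ r := by exact_mod_cast hr
  refine ⟨fun k => ?_, fun i => ⟨by positivity, (div_le_one (by linarith)).2 hr'⟩⟩
  rw [← mul_sum, sum_boole, show #{i | k ∈ G.N i} = r from h.1 k]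
  exact (one_div_mul_cancel (by linarith)).ge

/-- Sum the covering constraints over all users: each `α i` is counted `K - D = r * K / H` times. -/
theorem le_sum_of_isFeasible (h : G.IsSymmetricDesign r) (hr : 1 ≤ r) (hrH : r < H) (hK : 0 < K)
    {α : Fin H → ℝ} (hα : G.IsFeasible α) : (H : ℝ) / r ≤ ∑ i, α i := by
  have hr' : (0 : ℝ) < r := by exact_mod_cast hr
  have hK' : (0 : ℝ) < K := by exact_mod_cast hK
  obtain ⟨u, D, hD, -, -, -, e, -⟩ := h.exists_upCount_downCount hr hrH
  have hN : ∀ i, ((G.N i).card : ℝ) = K - D := fun i => by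
    have := card_add_card_compl (G.N i)
    rw [hD, Fintype.card_fin] at this
    have : ((G.N i).card : ℝ) + D = K := by exact_mod_cast this
    linarith
  have hs : ∑ _k : Fin K, (1 : ℝ) ≤ ∑ k, ∑ i, α i * (if k ∈ G.N i then 1 else 0) :=
    sum_le_sum fun k _ => hα.1 k
  rw [sum_comm] at hs
  simp only [← mul_sum, sum_boole, filter_univ_mem, hN, ← sum_mul] at hs
  simp only [sum_const, card_univ, Fintype.card_fin, nsmul_eq_mul, mul_one] at hs
  have hH : (0 : ℝ) < H := by exact_mod_cast (by omega : 0 < H)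
  rw [div_le_iff₀ hr']
  have := mul_le_mul_of_nonneg_left hs hH.le
  have e2 : (H : ℝ) * ((∑ i, α i) * (K - D)) = K * ((∑ i, α i) * r) := by
    linear_combination (-(∑ i, α i)) * e
  rw [e2, mul_comm, mul_le_mul_iff_right₀ hK'] at this
  exact this

theorem isOptimalSplit_const (h : G.IsSymmetricDesign r) (hr : 1 ≤ r) (hrH : r < H) (hK : 0 < K)
    (z : ℕ) : G.IsOptimalSplit z fun _ => 1 / (r : ℝ) := by
  refine ⟨h.isFeasible_const hr, fun α' hα' => ?_⟩
  obtain ⟨u, D, -, -, hu, -, -, -⟩ := h.exists_upCount_downCount hr hrH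
  simp only [objective, hu, ← mul_sum]
  refine mul_le_mul_of_nonneg_left ?_ (by positivity)
  refine le_trans (le_of_eq ?_) (h.le_sum_of_isFeasible hr hrH hK hα')
  simp [div_eq_mul_inv]

/-- In round `r` the objective is `u` times the sum, and `u > 0` because `r < H`, so optimality
fixes the sum even if the optimal solution is not unique. -/
theorem sum_of_isOptimalSplit (h : G.IsSymmetricDesign r) (hr : 1 ≤ r) (hrH : r < H) (hK : 0 < K)
    {α : Fin H → ℝ} (hα : G.IsOptimalSplit r α) : ∑ i, α i = (H : ℝ) / r := by
  refine le_antisymm ?_ (h.le_sum_of_isFeasible hr hrH hK hα.1)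
  have := hα.2 _ (h.isFeasible_const hr)
  obtain ⟨u, D, -, -, hu, -, -, e⟩ := h.exists_upCount_downCount hr hrH
  simp only [objective, hu, ← mul_sum, if_pos] at this
  have hu0 : (0 : ℝ) < u := by
    rcases Nat.eq_zero_or_pos u with rfl | hu0
    · have hr' : (0 : ℝ) < r := by exact_mod_cast hr
      have hK' : (0 : ℝ) < K := by exact_mod_cast hK
      have hH' : (0 : ℝ) < (H : ℝ) - r := sub_pos.2 (by exact_mod_cast hrH)
      have : (0 : ℝ) < K * (r * (H - r)) := by positivity
      rw [← e] at this
      simp at this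
    · exact_mod_cast hu0
  refine ((mul_le_mul_iff_right₀ hu0).1 this).trans (le_of_eq ?_)
  simp [div_eq_mul_inv]

theorem loads_of_isCoded (h : G.IsSymmetricDesign r) (hr : 1 ≤ r) (hrH : r < H) (hK : 0 < K)
    {V : ℕ} (hV : 0 < V) {φ : (Fin K → Bits V) → (Fin K → Bits V)} {S : Scheme G V φ}
    (hS : S.IsCoded) :
    S.upLoad = (K : ℝ) * ((H : ℝ) - r) / ((H : ℝ) - 1) ∧
      S.downLoad = (K : ℝ) - (r : ℝ) * K / H := by
  obtain ⟨P, -, hup, lay₀, -⟩ := hS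
  obtain ⟨u, D, -, -, hu, hd, eD, eu⟩ := h.exists_upCount_downCount hr hrH
  have hrR : r ∈ Icc 1 (H - 1) := by simp only [mem_Icc]; omega
  have hV' : (V : ℝ) ≠ 0 := by positivity
  have hr' : (r : ℝ) ≠ 0 := by positivity
  have hH : (H : ℝ) ≠ 0 := by
    have : 0 < H := by omega
    positivity
  have hH1 : (H : ℝ) - 1 ≠ 0 := by
    have : (1 : ℝ) < H := by exact_mod_cast (by omega : 1 < H)
    linarith
  constructor
  · have hT : ∀ i, (S.T i : ℝ) = u * V * P.α ⟨r, hrR⟩ i := fun i => by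
      obtain ⟨lay, -⟩ := hup i
      have hc := Fintype.card_congr lay
      simp only [Fintype.card_sigma, Fintype.card_prod, Fintype.card_fin] at hc
      -- Rounds other than `r` send no bits.
      rw [sum_eq_single ⟨r, hrR⟩ (fun z _ hz => by
        rw [hu, if_neg fun h => hz (Subtype.ext h), zero_mul]) (by simp), hu, if_pos rfl] at hc
      rw [hc]
      have hq : (P.q ⟨r, hrR⟩ : ℝ) * P.b ⟨r, hrR⟩ = V := by exact_mod_cast P.size ⟨r, hrR⟩
      push_cast
      rw [P.seg_size, ← hq]
      ring
    simp only [Scheme.upLoad, hT, ← mul_sum]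
    rw [h.sum_of_isOptimalSplit hr hrH hK (P.optimal ⟨r, hrR⟩)]
    field_simp
    linear_combination eu
  · have hc := Fintype.card_congr lay₀
    simp only [Fintype.card_sigma, Fintype.card_prod, Fintype.card_fin] at hc
    rw [sum_eq_single ⟨r, hrR⟩ (fun z _ hz => by
      rw [hd, if_neg fun h => hz (Subtype.ext h), mul_zero, zero_mul]) (by simp), hd,
      if_pos rfl, mul_right_comm, P.size] at hc
    rw [Scheme.downLoad, hc]
    push_cast
    field_simp
    linear_combination eD

end Network.IsSymmetricDesign

/-! ### From decodable coding parameters to a scheme -/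

namespace CodingParams

variable {H K : ℕ} {G : Network H K} {V : ℕ} (P : CodingParams G V)

theorem symbol_injective (z : Round H) {x y : Bits V}
    (h : ∀ p, P.symbol z x p = P.symbol z y p) : x = y := by
  funext t
  obtain ⟨⟨p, u⟩, hpu⟩ := finProdFinEquiv.surjective (Fin.cast (P.size z).symm t)
  have := congrFun ((P.ident z).injective (h p)) u
  simp only [hpu] at this
  exact this

theorem upSymbol_congr {v v' : Fin K → Bits V} {i : Fin H} (h : ∀ k ∈ G.N i, v k = v' k)
    (z : Round H) (j : Fin (G.upCount z i)) (t : Fin (P.s z i)) :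
    P.upSymbol v z i j t = P.upSymbol v' z i j t :=
  sum_congr rfl fun k hk => by rw [h k (mem_inter.1 hk).1]

/-- Coding parameters for which every relay can decode give a coded scheme. -/
theorem exists_isCoded (φ : (Fin K → Bits V) → (Fin K → Bits V))
    (hP : ∀ (i : Fin H) (v v' : Fin K → Bits V), (∀ k ∈ G.N i, v k = v' k) →
      (∀ z n, P.downSymbol v z n = P.downSymbol v' z n) → v = v') :
    ∃ S : Scheme G V φ, S.IsCoded := by
  classical
  let UpIdx := fun i => Σ z : Round H, Fin (G.upCount z i) × Fin (P.s z i) × Fin (P.b z)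
  let DownIdx := Σ z : Round H, Fin (P.q z * G.downCount z) × Fin (P.b z)
  let lay : (i : Fin H) → Fin (Fintype.card (UpIdx i)) ≃ UpIdx i :=
    fun i => (Fintype.equivFin _).symm
  let lay₀ : Fin (Fintype.card DownIdx) ≃ DownIdx := (Fintype.equivFin _).symm
  -- The value `0` outside `G.N i` is harmless: the uplink symbols of relay `i` do not depend on it.
  let ext : (i : Fin H) → ({k // k ∈ G.N i} → Bits V) → (Fin K → Bits V) :=
    fun i w k => if hk : k ∈ G.N i then w ⟨k, hk⟩ else 0
  have ext_eq : ∀ i (v : Fin K → Bits V), ∀ k ∈ G.N i, ext i (fun l => v l) k = v k :=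
    fun i v k hk => by simp [ext, hk]
  let upBit : (i : Fin H) → ({k // k ∈ G.N i} → Bits V) → UpIdx i → ZMod 2 :=
    fun i w x => (P.ident x.1).symm (P.upSymbol (ext i w) x.1 i x.2.1 x.2.2.1) x.2.2.2
  let up : (i : Fin H) → ({k // k ∈ G.N i} → Bits V) → Bits (Fintype.card (UpIdx i)) :=
    fun i w t => upBit i w (lay i t)
  let downBit : ((i : Fin H) → Bits (Fintype.card (UpIdx i))) → DownIdx → ZMod 2 :=
    fun X x => (P.ident x.1).symm (∑ i, ∑ j, ∑ s, P.d x.1 x.2.1 i j s *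
        P.ident x.1 fun u => X i ((lay i).symm ⟨x.1, j, s, u⟩)) x.2.2
  let down : ((i : Fin H) → Bits (Fintype.card (UpIdx i))) → Bits (Fintype.card DownIdx) :=
    fun X t => downBit X (lay₀ t)
  have up_eq : ∀ (v : Fin K → Bits V) i (z : Round H) j s,
      P.ident z (fun u => up i (fun l => v l) ((lay i).symm ⟨z, j, s, u⟩)) =
        P.upSymbol v z i j s := fun v i z j s => by
    have e : (fun u => up i (fun l => v l) ((lay i).symm ⟨z, j, s, u⟩)) =
        (P.ident z).symm (P.upSymbol (ext i fun l => v l) z i j s) :=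
      funext fun u => congrArg (upBit i fun l => v l) ((lay i).apply_symm_apply ⟨z, j, s, u⟩)
    rw [e, (P.ident z).apply_symm_apply]
    exact P.upSymbol_congr (ext_eq i v) z j s
  have down_eq : ∀ (v : Fin K → Bits V) (z : Round H) n,
      P.ident z (fun u => down (fun i => up i fun l => v l) (lay₀.symm ⟨z, n, u⟩)) =
        P.downSymbol v z n := fun v z n => by
    have e : (fun u => down (fun i => up i fun l => v l) (lay₀.symm ⟨z, n, u⟩)) =
        (P.ident z).symm (∑ i, ∑ j, ∑ s, P.d z n i j s *
          P.ident z fun u => up i (fun l => v l) ((lay i).symm ⟨z, j, s, u⟩)) :=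
      funext fun u => congrArg (downBit fun i => up i fun l => v l)
        (lay₀.apply_symm_apply ⟨z, n, u⟩)
    rw [e, (P.ident z).apply_symm_apply]
    simp only [up_eq]
    rfl
  -- Decoding picks any IVs consistent with the observations; `hP` makes them unique.
  let dec : (i : Fin H) → Bits (Fintype.card DownIdx) → ({k // k ∈ G.N i} → Bits V) →
      (Fin K → Bits V) := fun i x w =>
    if hv : ∃ v : Fin K → Bits V,
      down (fun j => up j fun l => v l) = x ∧ (fun l : {k // k ∈ G.N i} => v l) = w
    then hv.choose else 0
  have dec_eq : ∀ (v : Fin K → Bits V) i,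
      dec i (down fun j => up j fun l => v l) (fun l => v l) = v := fun v i => by
    have hv : ∃ v' : Fin K → Bits V, (down fun j => up j fun l => v' l) =
        (down fun j => up j fun l => v l) ∧
        (fun l : {k // k ∈ G.N i} => v' l) = fun l : {k // k ∈ G.N i} => v l := ⟨v, rfl, rfl⟩
    have hd : dec i (down fun j => up j fun l => v l) (fun l => v l) = hv.choose := dif_pos hv
    rw [hd]
    refine hP i _ _ (fun k hk => congrFun hv.choose_spec.2 ⟨k, hk⟩) fun z n => ?_
    rw [← down_eq, ← down_eq, hv.choose_spec.1]
  let S : Scheme G V φ :=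
    { TU := fun _ => V
      T := fun i => Fintype.card (UpIdx i)
      T₀ := Fintype.card DownIdx
      TE := fun _ => K * V
      loc := G.N
      loc_subset := fun _ => subset_rfl
      userEnc := fun _ x => x
      localDec := fun _ w => w
      relayEnc := up
      serverEnc := down
      relayDec := dec
      -- Each relay forwards all updated models, and each user reads its block from one chosen
      -- relay; the load on this hop is not measured.
      relayDownEnc := fun i x w t =>
        φ (dec i x w) (finProdFinEquiv.symm t).1 (finProdFinEquiv.symm t).2
      userDec := fun k w t =>
        w ⟨(G.cover k).choose, (G.cover k).choose_spec⟩ (finProdFinEquiv (k, t))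
      localDec_correct := fun _ _ _ => rfl
      relayDec_correct := dec_eq
      userDec_correct := fun v k => by
        funext t
        simp only [dec_eq, Equiv.symm_apply_apply] }
  exact ⟨S, P, ⟨fun _ => rfl, fun _ _ _ => rfl⟩, fun i => ⟨lay i, fun v z j s => up_eq v i z j s⟩,
    lay₀, down_eq⟩

end CodingParams

/-! ### Coefficients for the relays and the server -/

/-- Combinations with Vandermonde coefficients determine their arguments. -/
theorem Finset.eq_zero_of_sum_pow_mul_eq_zero {F ι : Type*} [Field F] {a : ι → F}
    (ha : Function.Injective a) (s : Finset ι) {x : ι → F}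
    (hx : ∀ j < #s, ∑ k ∈ s, a k ^ j * x k = 0) : ∀ k ∈ s, x k = 0 := by
  intro k hk
  have := Matrix.eq_zero_of_forall_pow_sum_mul_pow_eq_zero (R := F)
    (f := fun l => a (s.equivFin.symm l)) (v := fun l => x (s.equivFin.symm l))
    (fun l l' h => s.equivFin.symm.injective (Subtype.ext (ha h))) (fun j => by
      rw [← hx j j.2, ← sum_coe_sort s]
      exact Fintype.sum_equiv s.equivFin.symm _ _ fun l => mul_comm _ _)
  simpa using congrFun this (s.equivFin ⟨k, hk⟩)

/-- If each of `H` relays holds `u` symbols, then `(H - 1) * u` combinations of them suffice for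
every relay to learn the symbols of all the others. -/
theorem exists_broadcast_coefficients {F : Type*} [Field F] {H u N s : ℕ} (hH : 0 < H)
    (hs : s = 1) (hN : N = (H - 1) * u) {n : Fin H → ℕ} (hn : ∀ i, n i = u) :
    ∃ d : Fin N → (i : Fin H) → Fin (n i) → Fin s → F,
      ∀ (y y' : (i : Fin H) → Fin (n i) → Fin s → F) (l : Fin H), y l = y' l →
        (∀ m, ∑ i, ∑ j, ∑ t, d m i j t * y i j t = ∑ i, ∑ j, ∑ t, d m i j t * y' i j t) →
        y = y' := by
  obtain rfl : n = fun _ => u := funext hn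
  subst hs hN
  let i₀ : Fin H := ⟨0, hH⟩
  have hc : Fintype.card ({i // i ≠ i₀} × Fin u) = (H - 1) * u := by
    simp [Fintype.card_subtype_compl]
  let e := (Fintype.equivFinOfCardEq hc).symm
  -- Combination `(i, j)` is `y i₀ j + y i j`. Relay `l` subtracts its own symbols to get those of
  -- `i₀`, then those of every other relay.
  refine ⟨fun m i j _ => if j = (e m).2 then
    (if i = i₀ then 1 else 0) + (if i = (e m).1.1 then 1 else 0) else 0, fun y y' l hl h => ?_⟩
  have key : ∀ (i : Fin H) (j : Fin u), i ≠ i₀ →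
      y i₀ j 0 + y i j 0 = y' i₀ j 0 + y' i j 0 := fun i j hi => by
    have := h (e.symm (⟨i, hi⟩, j))
    simpa [add_mul, sum_add_distrib] using this
  have h0 : ∀ j, y i₀ j 0 = y' i₀ j 0 := fun j => by
    by_cases hl0 : l = i₀
    · rw [← hl0, hl]
    · have := key l j hl0
      rwa [hl, add_left_inj] at this
  funext i j t
  rw [Subsingleton.elim t 0]
  by_cases hi : i = i₀
  · rw [hi, h0]
  · have := key i j hi
    rwa [h0, add_right_inj] at this

/-! ### Decodable parameters for a symmetric design -/

namespace Network.IsSymmetricDesign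

variable {H K r : ℕ} {G : Network H K}

theorem exists_codingParams (h : G.IsSymmetricDesign r) (hr : 1 ≤ r) (hrH : r < H) (hK : 0 < K)
    {m : ℕ} (hm : K ≤ m) :
    ∃ P : CodingParams G (r * m), ∀ (i : Fin H) (v v' : Fin K → Bits (r * m)),
      (∀ k ∈ G.N i, v k = v' k) → (∀ z n, P.downSymbol v z n = P.downSymbol v' z n) →
        v = v' := by
  obtain ⟨u, D, hD, hsd, hu, hd, eD, eu⟩ := h.exists_upCount_downCount hr hrH
  have hm0 : m ≠ 0 := by omega
  have hrR : r ∈ Icc 1 (H - 1) := by simp only [mem_Icc]; omega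
  have hr' : (r : ℝ) ≠ 0 := by positivity
  -- The server's budget `q * downCount` with `q = r` equals the number of combinations that the
  -- broadcast code uses.
  have hrD : r * D = (H - 1) * u := by
    have hH : (H : ℝ) ≠ 0 := by
      have : 0 < H := by omega
      positivity
    have : (r * D : ℝ) = (H - 1) * u := mul_left_cancel₀ hH (by linear_combination r * eD - eu)
    have : ((r * D : ℕ) : ℝ) = ((H - 1) * u : ℕ) := by
      push_cast [(by omega : 1 ≤ H)]
      exact this
    exact_mod_cast this
  let ident : Bits m ≃ₗ[ZMod 2] GaloisField 2 m := LinearEquiv.ofFinrankEq _ _ (by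
    rw [GaloisField.finrank 2 hm0, Module.finrank_fin_fun])
  -- Distinct Vandermonde nodes for the users, available because `K ≤ m < 2 ^ m`.
  obtain ⟨a, ha⟩ : ∃ a : Fin K → GaloisField 2 m, Function.Injective a := by
    have := Fintype.ofFinite (GaloisField 2 m)
    have hle : Fintype.card (Fin K) ≤ Fintype.card (GaloisField 2 m) := by
      rw [← Nat.card_eq_fintype_card (α := GaloisField 2 m), GaloisField.card 2 m hm0,
        Fintype.card_fin]
      exact hm.trans Nat.lt_two_pow_self.le
    obtain ⟨a⟩ := Function.Embedding.nonempty_of_card_le hle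
    exact ⟨a, a.injective⟩
  choose d hdec using fun z : Round H => exists_broadcast_coefficients (F := GaloisField 2 m)
    (H := H) (u := if z.1 = r then u else 0) (N := r * G.downCount z) (n := G.upCount z)
    (by omega) rfl (by rw [hd]; split_ifs <;> simp [hrD]) (hu z)
  -- The `r` symbols of an IV are matched bijectively with the `r` relays of its user; the value at
  -- other relays is never used.
  let seg : (k : Fin K) → (i : Fin H) → Fin r := fun k i =>
    if hi : i ∈ G.relays k then Finset.equivFinOfCardEq (h.1 k) ⟨i, hi⟩ else ⟨0, hr⟩
  have seg_cover : ∀ k p, ∃ i, k ∈ G.N i ∧ seg k i = p := fun k p => by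
    let i := (Finset.equivFinOfCardEq (h.1 k)).symm p
    refine ⟨i, G.mem_relays.1 i.2, ?_⟩
    simp [seg, i]
  let P : CodingParams G (r * m) :=
    { α := fun _ _ => 1 / r
      optimal := fun z => h.isOptimalSplit_const hr hrH hK z
      q := fun _ => r
      b := fun _ => m
      size := fun _ => rfl
      s := fun _ _ => 1
      seg_size := fun _ _ => by simp [hr']
      ident := fun _ => ident
      seg := fun _ k i _ => seg k i
      seg_cover := fun _ k _ p => by
        obtain ⟨i, hi, hp⟩ := seg_cover k p
        exact ⟨i, hi, 0, hp⟩
      c := fun _ _ j k => a k ^ (j : ℕ)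
      d := d }
  refine ⟨P, fun l v v' hl hdown => ?_⟩
  let z : Round H := ⟨r, hrR⟩
  have hup : P.upSymbol v z = P.upSymbol v' z :=
    hdec z _ _ l (funext fun j => funext fun t => P.upSymbol_congr hl z j t) fun n => hdown z n
  funext k
  by_cases hk : k ∈ G.N l
  · exact hl k hk
  refine P.symbol_injective z fun p => ?_
  obtain ⟨i, hi, rfl⟩ := seg_cover k p
  have hil : i ≠ l := by
    rintro rfl
    exact hk hi
  rw [← sub_eq_zero]
  -- The differences of the segments vanish on `G.N l`, so the `u` combinations of relay `i` form a
  -- Vandermonde system in the `u` unknowns indexed by `G.N i \ G.N l`.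
  refine eq_zero_of_sum_pow_mul_eq_zero (F := GaloisField 2 m) ha (G.N i \ G.N l)
    (x := fun k => P.symbol z (v k) (seg k i) - P.symbol z (v' k) (seg k i)) (fun j hj => ?_) k
    (mem_sdiff.2 ⟨hi, hk⟩)
  have hj' : j < G.upCount z i := by
    rw [hu, if_pos rfl, ← hsd i l hil]
    exact hj
  have e := congrFun (congrFun (congrFun hup i) ⟨j, hj'⟩) (0 : Fin 1)
  simp only [CodingParams.upSymbol, h.usersOf_eq, z, if_pos, inter_univ] at e
  rw [← sub_eq_zero, ← sum_sub_distrib] at e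
  simp only [← mul_sub] at e
  rw [← e]
  refine sum_subset sdiff_subset fun k' hk' hk'' => ?_
  have : k' ∈ G.N l := by
    by_contra hn
    exact hk'' (mem_sdiff.2 ⟨hk', hn⟩)
  rw [hl k' this, sub_self, mul_zero]

end Network.IsSymmetricDesign

/-! ### Combining achievability and converse -/

theorem theorem3 (H K r : ℕ) (hr : 1 ≤ r) (hrH : r < H) (hK : 0 < K) (hdvd : H.choose r ∣ K) :
    (∃ G : Network H K, G.IsSymmetricDesign r) ∧
    ∀ G : Network H K, G.IsSymmetricDesign r →
      G.avgConnectivity = r ∧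
      ∀ φ : GlobalUpdate K,
        -- the coded scheme exists for all sufficiently large IV sizes divisible by `r`
        (∃ m₀ : ℕ, ∀ m : ℕ, m₀ ≤ m → ∃ S : Scheme G (r * m) (φ (r * m)), S.IsCoded) ∧
        -- its loads
        (∀ V : ℕ, 0 < V → ∀ S : Scheme G V (φ V), S.IsCoded →
          S.upLoad = (K : ℝ) * ((H : ℝ) - r) / ((H : ℝ) - 1) ∧
          S.downLoad = (K : ℝ) - (r : ℝ) * K / H) ∧
        -- both loads are achieved at the same time and are optimal for this network
        G.Achievable φ ((K : ℝ) * ((H : ℝ) - r) / ((H : ℝ) - 1)) ((K : ℝ) - (r : ℝ) * K / H) ∧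
        IsLeast (G.upLoads φ) ((K : ℝ) * ((H : ℝ) - r) / ((H : ℝ) - 1)) ∧
        IsLeast (G.downLoads φ) ((K : ℝ) - (r : ℝ) * K / H) ∧
        -- they are optimal among all networks with average user connectivity `r`
        IsLeast {L : ℝ | ∃ G' : Network H K, G'.avgConnectivity = r ∧ L ∈ G'.upLoads φ}
          ((K : ℝ) * ((H : ℝ) - r) / ((H : ℝ) - 1)) ∧
        IsLeast {L : ℝ | ∃ G' : Network H K, G'.avgConnectivity = r ∧ L ∈ G'.downLoads φ}
          ((K : ℝ) - (r : ℝ) * K / H) := by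

  have hH : 1 < H := by omega
  refine ⟨Network.exists_isSymmetricDesign hr hrH hK hdvd, fun G hG => ?_⟩
  have hc := hG.avgConnectivity_eq hK
  refine ⟨hc, fun φ => ?_⟩
  have hex : ∀ m : ℕ, K ≤ m → ∃ S : Scheme G (r * m) (φ (r * m)), S.IsCoded := fun m hm => by
    obtain ⟨P, hP⟩ := hG.exists_codingParams hr hrH hK hm
    exact P.exists_isCoded _ hP
  have hach : G.Achievable φ ((K : ℝ) * ((H : ℝ) - r) / ((H : ℝ) - 1))
      ((K : ℝ) - (r : ℝ) * K / H) := by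
    obtain ⟨S, hS⟩ := hex K le_rfl
    have hV : 0 < r * K := Nat.mul_pos hr hK
    exact ⟨r * K, hV, S, hG.loads_of_isCoded hr hrH hK hV hS⟩
  have hup : ∀ G' : Network H K, G'.avgConnectivity = r →
      (K : ℝ) * ((H : ℝ) - r) / ((H : ℝ) - 1) ∈ lowerBounds (G'.upLoads φ) := by
    rintro G' hG' L ⟨L', V, hV, S, rfl, -⟩
    exact S.le_upLoad hV hH hK hG'
  have hdown : ∀ G' : Network H K, G'.avgConnectivity = r →
      (K : ℝ) - (r : ℝ) * K / H ∈ lowerBounds (G'.downLoads φ) := by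
    rintro G' hG' L ⟨L', V, hV, S, -, rfl⟩
    exact S.le_downLoad hV (by omega) hK hG'
  refine ⟨⟨K, hex⟩, fun V hV S hS => hG.loads_of_isCoded hr hrH hK hV hS, hach,
    ⟨⟨_, hach⟩, hup G hc⟩, ⟨⟨_, hach⟩, hdown G hc⟩, ⟨⟨G, hc, _, hach⟩, ?_⟩,
    ⟨⟨G, hc, _, hach⟩, ?_⟩⟩
  · rintro L ⟨G', hG', hL⟩
    exact hup G' hG' hL
  · rintro L ⟨G', hG', hL⟩
    exact hdown G' hG' hL
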